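/- For positive integers $N,S,k$ and a map $G_{N,S}:\{1,\dots,S\}\to\{-1,+1\}^N$, $G_{N,S}(s)=(e_1(s),\dots,e_N(s))$, let the cross-correlation measure of order $k$ be $$\Phi_k(G_{N,S})=\max\left|\sum_{n=1}^{M}e_{n+d_1}(s_1)\cdots e_{n+d_k}(s_k)\right|,$$ where the maximum is over all integers $M,d_1,\dots,d_k$ and $1\le s_1,\dots,s_k\le S$ with $0\le d_1\le\dots\le d_k<M+d_k\le N$ and $d_i\ne d_j$ whenever $i\neq j$ and $s_i=s_j$. Let $G_{N,S}$ be random: all $e_n(s)$ ($1\le n\le N$, $1\le s\le S$) are independent and uniform on $\{-1,+1\}$. Theorem. For every $\varepsilon>0$ there is an integer $N_0=N_0(\varepsilon)$ such that for all integers $N\ge N_0$, all integers $S\ge 1$ with $12\log_2 S\le N$, and all integers $k$ with $$2\le k\le\frac{\log N+\log S}{\log\log N},$$ the probability that $$1-\varepsilon<\frac{\Phi_k(G_{N,S})}{\mathbb{E}[\Phi_k(G_{N,S})]}<1+\varepsilon$$ is at least $1-\varepsilon$. Here $\log$ is the natural logarithm. (In particular, this holds for any fixed $S$ and any integer function $k=k(N)$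 in this range, for all $N\ge\max(N_0,12\log_2 S)$.) -/

import Mathlib

open MeasureTheory

namespace CrossCorrelation

/-- A map `G : {1, …, S} → {-1, +1}^N`, i.e. `S` binary sequences of length `N`. Both indices are
counted from `0`, and `ℤˣ` is the two-element set `{1, -1}`. -/
abbrev SeqFamily (N S : ℕ) : Type := Fin S → Fin N → ℤˣ

/-- The entry of the `s`-th sequence at position `n` as an integer. Positions `n ≥ N`, where the
value is set to `0`, never occur in the definition of the cross-correlation measure. -/
def entry {N S : ℕ} (G : SeqFamily N S) (s : Fin S) (n : ℕ) : ℤ :=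
  if h : n < N then (G s ⟨n, h⟩ : ℤ) else 0

/-- The admissible `(M, d, s)` for order `k`: `0 ≤ d₁ ≤ ⋯ ≤ d_k < M + d_k ≤ N`, and
`d_i ≠ d_j` whenever `i ≠ j` and `s_i = s_j`. -/
def Admissible {N S k : ℕ} (M : ℕ) (d : Fin k → Fin N) (s : Fin k → Fin S) : Prop :=
  1 ≤ M ∧ (∀ i j, i ≤ j → d i ≤ d j) ∧ (∀ i, M + (d i : ℕ) ≤ N) ∧
    ∀ i j, i ≠ j → s i = s j → d i ≠ d j

instance {N S k : ℕ} (M : ℕ) (d : Fin k → Fin N) (s : Fin k → Fin S) :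
    Decidable (Admissible M d s) := by
  unfold Admissible
  infer_instance

/-- The sum `∑_{n=1}^{M} e_{n+d₁}(s₁) ⋯ e_{n+d_k}(s_k)`. -/
def corrSum {N S k : ℕ} (G : SeqFamily N S) (M : ℕ) (d : Fin k → Fin N) (s : Fin k → Fin S) : ℤ :=
  ∑ n ∈ Finset.range M, ∏ i, entry G (s i) (n + d i)

/-- The cross-correlation measure of order `k` of `G`: the maximum of the absolute values of the
sums `corrSum` over all admissible `(M, d, s)`. -/
def crossCorr {N S : ℕ} (k : ℕ) (G : SeqFamily N S) : ℕ :=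
  (Finset.univ.filter fun p : Fin (N + 1) × (Fin k → Fin N) × (Fin k → Fin S) =>
    Admissible (p.1 : ℕ) p.2.1 p.2.2).sup
      fun p => (corrSum G (p.1 : ℕ) p.2.1 p.2.2).natAbs

/-- Every subset of `{1, -1}` is measurable. -/
instance : DiscreteMeasurableSpace ℤˣ :=
  ⟨fun A => ⟨Units.val '' A, MeasurableSet.of_discrete, Set.preimage_image_eq A Units.val_injective⟩⟩

/-- The law of a random family: all entries are independent and uniform on `{1, -1}`. -/
noncomputable def randomFamily (N S : ℕ) : Measure (SeqFamily N S) :=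
  Measure.pi fun _ => Measure.pi fun _ => ProbabilityTheory.uniformOn Set.univ

/-- The mean of the cross-correlation measure of order `k` of a random family. -/
noncomputable def meanCrossCorr (N S k : ℕ) : ℝ :=
  ∫ G, (crossCorr k G : ℝ) ∂(randomFamily N S)

end CrossCorrelation

/-!
The proof compares the variance of `Φ = crossCorr k G` with its squared mean.

*Variance.* Let `(M, d, s)` be a maximising choice for `G`, and let `m s` be the number of indices
`i` with `s i = s`. A sign change of one entry of the `s`-th sequence lowers `Φ` by at most
`2 * m s`. As `∑ s, m s = k`, the squares of these bounds add up to at most `4 * N * k ^ 2` over all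
entries, and the one-sided Efron-Stein inequality `efron_stein_of_decrease` gives
`Var Φ ≤ 2 * N * k ^ 2` with no dependence on `S` (`variance_crossCorr_le`). It remains to show that
the mean of `Φ` is much larger than `k * √N`.

*Mean.* Fix a sequence `s₀` and consider the correlation sums whose shifts are `0` for `s₀` and
otherwise a `(k - 1)`-set `D` of pairs (shift, sequence) that avoids the first `M` entries of `s₀`.
For distinct `D` the vectors of summands are pairwise independent and uniform
(`shiftProd_pair_surjective`): the first `M` entries of `s₀` enter each of them in the same way and
make one vector uniform, and the ratio of two vectors depends on the other entries only and takes
every value. The second moment method (`card_avoid_mul_le`) shows that a value which a sum of `M`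
random signs reaches with probability `p` is reached by one of `L` such sums with probability at
least `1 - 1 / (p * L)`. A sum of `M = q * b` signs is at least `q * √b / 2` in absolute value with
probability at least `12⁻¹ ^ q` (`two_pow_le_card_sq_sum`), and for `k` in the given range `log L`
is at least `k ^ 2 * log (log N) / 4`, so that `q = C * k ^ 2` is allowed for any constant `C`. If
`q ≤ N / 6`, one may take `M` of order `N`; the squared mean is then at least `C * k ^ 2 * N / 96`,
and Chebyshev's inequality finishes the proof.

*Large order.* If `C * k ^ 2 > N / 6`, then `S` is so large that the same argument with `M = N`
and all shifts equal to `0` produces `k` distinct sequences with product identically `1`, and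
`Φ = N` with high probability (`one_sub_le_real_length_le_crossCorr`). Since `Φ ≤ N` always, the
mean is close to `N` too.
-/

namespace CrossCorrelation

/-! ### The Efron-Stein inequality on the discrete cube -/

theorem sum_signs_fin_succ {n : ℕ} (f : (Fin (n + 1) → ℤˣ) → ℝ) :
    ∑ x, f x = ∑ x : Fin n → ℤˣ, f (Fin.cons 1 x) + ∑ x : Fin n → ℤˣ, f (Fin.cons (-1) x) := by
  rw [← (Fin.consEquiv (fun _ => ℤˣ)).sum_comp, Fintype.sum_prod_type]
  have : (Finset.univ : Finset ℤˣ) = {1, -1} := rfl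
  rw [this, Finset.sum_pair (by decide)]
  rfl

/-- The cube `{1, -1} ^ n` by induction: split along the first coordinate. The variance of `f` is
the mean of the variances on the two halves plus a quarter of the squared difference of the two
means, and Cauchy-Schwarz bounds the latter by the first coordinate's term. -/
theorem efron_stein_fin (n : ℕ) (f : (Fin n → ℤˣ) → ℝ) :
    4 * (2 ^ n * ∑ x, f x ^ 2 - (∑ x, f x) ^ 2) ≤
      2 ^ n * ∑ i, ∑ x, (f x - f (Function.update x i (-x i))) ^ 2 := by
  induction n with
  | zero => simp
  | succ n ih =>
    have h0 := ih fun x => f (Fin.cons 1 x)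
    have h1 := ih fun x => f (Fin.cons (-1) x)
    rw [Fin.sum_univ_succ]
    simp only [sum_signs_fin_succ, Fin.cons_zero, Fin.cons_succ, Fin.update_cons_zero,
      ← Fin.cons_update, neg_neg, Finset.sum_add_distrib] at h0 h1 ⊢
    have hcs : (∑ x : Fin n → ℤˣ, f (Fin.cons 1 x) - ∑ x : Fin n → ℤˣ, f (Fin.cons (-1) x)) ^ 2 ≤
        2 ^ n * ∑ x : Fin n → ℤˣ, (f (Fin.cons 1 x) - f (Fin.cons (-1) x)) ^ 2 := by
      rw [← Finset.sum_sub_distrib]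
      refine (sq_sum_le_card_mul_sum_sq (s := Finset.univ)).trans_eq ?_
      simp
    have hsymm : ∑ x : Fin n → ℤˣ, (f (Fin.cons (-1) x) - f (Fin.cons 1 x)) ^ 2 =
        ∑ x : Fin n → ℤˣ, (f (Fin.cons 1 x) - f (Fin.cons (-1) x)) ^ 2 :=
      Finset.sum_congr rfl fun x _ => by ring
    -- With `A`, `B` the sums of `f` over the two halves, the claim is the sum of the two induction
    -- hypotheses and of `(A - B) ^ 2 = 2 * A ^ 2 + 2 * B ^ 2 - (A + B) ^ 2`, bounded by `hcs`.
    rw [hsymm, pow_succ]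
    linarith

/-- The Efron-Stein inequality on the discrete cube, multiplied through by the powers of `2` that
normalise the averages: the variance of `f` is at most a quarter of the sum over the coordinates
`i` of the mean square of the change of `f` when `x i` changes sign. -/
theorem efron_stein {ι : Type*} [Fintype ι] [DecidableEq ι] (f : (ι → ℤˣ) → ℝ) :
    4 * (2 ^ Fintype.card ι * ∑ x, f x ^ 2 - (∑ x, f x) ^ 2) ≤
      2 ^ Fintype.card ι * ∑ i, ∑ x, (f x - f (Function.update x i (-x i))) ^ 2 := by
  let e := Fintype.equivFin ι
  let E : (Fin (Fintype.card ι) → ℤˣ) ≃ (ι → ℤˣ) := e.symm.arrowCongr (Equiv.refl _)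
  have h := efron_stein_fin _ fun x => f (E x)
  have hE : ∀ x i, E (Function.update x i (-x i)) =
      Function.update (E x) (e.symm i) (-(E x (e.symm i))) := by
    intro x i
    ext j
    simp only [E, Equiv.arrowCongr_apply, Equiv.symm_symm, Function.comp_apply, Equiv.refl_apply,
      Function.update_apply, Equiv.apply_symm_apply]
    simp only [Equiv.eq_symm_apply]
  simp only [hE] at h
  rw [E.sum_comp fun x => f x ^ 2, E.sum_comp f] at h
  rw [← e.symm.sum_comp]
  refine h.trans_eq ?_
  congr 1
  refine Finset.sum_congr rfl fun i _ => ?_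
  exact E.sum_comp fun x => (f x - f (Function.update x (e.symm i) (-x (e.symm i)))) ^ 2

/-- A one-sided form of `efron_stein`: only the decrease of `f` under a sign change has to be
controlled, by a bound `c x i` that may depend on the point `x`. It holds because `x` and its flip
at `i` occur symmetrically in the sum, so that each change is a decrease at one of the two points.
-/
theorem efron_stein_of_decrease {ι : Type*} [Fintype ι] [DecidableEq ι] (f : (ι → ℤˣ) → ℝ)
    (c : (ι → ℤˣ) → ι → ℝ)
    (hc : ∀ x i, f x - f (Function.update x i (-x i)) ≤ c x i) (V : ℝ)
    (hV : ∀ x, ∑ i, c x i ^ 2 ≤ V) :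
    2 ^ Fintype.card ι * ∑ x, f x ^ 2 - (∑ x, f x) ^ 2 ≤
      (2 ^ Fintype.card ι) ^ 2 * (V / 2) := by
  have key : ∀ i, ∑ x, (f x - f (Function.update x i (-x i))) ^ 2 ≤ 2 * ∑ x, c x i ^ 2 := by
    intro i
    have hinv : Function.Involutive fun x : ι → ℤˣ => Function.update x i (-x i) := by
      intro x; simp
    calc ∑ x, (f x - f (Function.update x i (-x i))) ^ 2
        ≤ ∑ x, (c x i ^ 2 + c (Function.update x i (-x i)) i ^ 2) := by
          refine Finset.sum_le_sum fun x _ => ?_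
          have h1 := hc x i
          have h2 := hc (Function.update x i (-x i)) i
          have h3 := hinv x
          simp only at h3
          rw [h3] at h2
          rcases le_total 0 (f x - f (Function.update x i (-x i))) with h | h
          · nlinarith [h.trans h1, sq_nonneg (c (Function.update x i (-x i)) i)]
          · nlinarith [sq_nonneg (c x i)]
      _ = 2 * ∑ x, c x i ^ 2 := by
          rw [Finset.sum_add_distrib, two_mul]
          congr 1
          exact (Equiv.sum_comp hinv.toPerm fun x => c x i ^ 2)
  have h := efron_stein f
  have hsum : ∑ i, ∑ x, (f x - f (Function.update x i (-x i))) ^ 2 ≤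
      2 * (2 ^ Fintype.card ι * V) := by
    calc _ ≤ ∑ i, 2 * ∑ x, c x i ^ 2 := Finset.sum_le_sum fun i _ => key i
      _ = 2 * ∑ x, ∑ i, c x i ^ 2 := by rw [← Finset.mul_sum, Finset.sum_comm]
      _ ≤ 2 * ∑ _x : ι → ℤˣ, V := by gcongr with x; exact hV x
      _ = _ := by simp
  have := mul_le_mul_of_nonneg_left hsum (show (0 : ℝ) ≤ 2 ^ Fintype.card ι by positivity)
  linarith

/-! ### Lower tails of sums of random signs -/

theorem sum_sq_sum_signs (b : ℕ) :
    ∑ z : Fin b → ℤˣ, (∑ i, ((z i : ℤ) : ℝ)) ^ 2 = b * 2 ^ b := by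
  induction b with
  | zero => simp
  | succ b ih =>
    rw [sum_signs_fin_succ, ← Finset.sum_add_distrib]
    simp only [Fin.sum_univ_succ, Fin.cons_zero, Fin.cons_succ]
    have : ∀ x : Fin b → ℤˣ, ((((1 : ℤˣ) : ℤ) : ℝ) + ∑ i, ((x i : ℤ) : ℝ)) ^ 2 +
        ((((-1 : ℤˣ) : ℤ) : ℝ) + ∑ i, ((x i : ℤ) : ℝ)) ^ 2 =
        2 * (∑ i, ((x i : ℤ) : ℝ)) ^ 2 + 2 := by
      intro x; push_cast; ring
    simp only [this, Finset.sum_add_distrib, ← Finset.mul_sum, ih]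
    simp
    ring

theorem sum_pow_four_sum_signs_le (b : ℕ) :
    ∑ z : Fin b → ℤˣ, (∑ i, ((z i : ℤ) : ℝ)) ^ 4 ≤ 3 * (b : ℝ) ^ 2 * 2 ^ b := by
  induction b with
  | zero => simp
  | succ b ih =>
    rw [sum_signs_fin_succ, ← Finset.sum_add_distrib]
    simp only [Fin.sum_univ_succ, Fin.cons_zero, Fin.cons_succ]
    have : ∀ x : Fin b → ℤˣ, ((((1 : ℤˣ) : ℤ) : ℝ) + ∑ i, ((x i : ℤ) : ℝ)) ^ 4 +
        ((((-1 : ℤˣ) : ℤ) : ℝ) + ∑ i, ((x i : ℤ) : ℝ)) ^ 4 =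
        2 * (∑ i, ((x i : ℤ) : ℝ)) ^ 4 + 12 * (∑ i, ((x i : ℤ) : ℝ)) ^ 2 + 2 := by
      intro x; push_cast; ring
    simp only [this, Finset.sum_add_distrib, ← Finset.mul_sum, sum_sq_sum_signs]
    simp only [Finset.sum_const, Finset.card_univ, Fintype.card_pi, Fintype.card_units_int,
      Finset.prod_const, Fintype.card_fin, nsmul_eq_mul]
    push_cast
    rw [pow_succ (2 : ℝ)]
    nlinarith [show (0 : ℝ) < 2 ^ b by positivity]

/-- The sign vectors of length `b` whose sum is at least `√b / 2`, written without square roots. -/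
def largeSums (b : ℕ) : Finset (Fin b → ℤˣ) :=
  {z | 0 ≤ ∑ i, (z i : ℤ) ∧ (b : ℤ) ≤ 4 * (∑ i, (z i : ℤ)) ^ 2}

/-- A sum of `b` random signs is at least `√b / 2` with probability at least `1 / 12`. -/
theorem two_pow_le_card_largeSums (b : ℕ) : 2 ^ b ≤ 12 * (largeSums b).card := by
  classical
  rcases Nat.eq_zero_or_pos b with rfl | hb
  · simp [largeSums]
  set T : Finset (Fin b → ℤˣ) := {z | (b : ℤ) ≤ 4 * (∑ i, (z i : ℤ)) ^ 2} with hT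
  have hTle : T.card ≤ 2 * (largeSums b).card := by
    have hsub : T ⊆ largeSums b ∪ (largeSums b).image (fun z => -z) := by
      intro z hz
      simp only [hT, Finset.mem_filter, Finset.mem_univ, true_and] at hz
      rcases le_total 0 (∑ i, (z i : ℤ)) with h | h
      · exact Finset.mem_union_left _ (by simp [largeSums, h, hz])
      · refine Finset.mem_union_right _ (Finset.mem_image.2 ⟨-z, ?_, neg_neg z⟩)
        simp [largeSums, h, hz]
    calc T.card ≤ _ := Finset.card_le_card hsub
      _ ≤ (largeSums b).card + ((largeSums b).image fun z => -z).card :=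
        Finset.card_union_le _ _
      _ ≤ (largeSums b).card + (largeSums b).card :=
        Nat.add_le_add_left Finset.card_image_le _
      _ = _ := by ring
  have hb' : (0 : ℝ) < b := by exact_mod_cast hb
  -- With `u = X ^ 2 / b`, the indicator of `u ≥ 1 / 4` is at least `(u - 1 / 4) * (6 - u) / 9`,
  -- whose mean is at least `7 / 36` by the second and fourth moments of `X`.
  have hpt : ∀ z : Fin b → ℤˣ,
      25 / 4 * b * (∑ i, ((z i : ℤ) : ℝ)) ^ 2 - (∑ i, ((z i : ℤ) : ℝ)) ^ 4 - 3 / 2 * (b : ℝ) ^ 2 ≤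
        if z ∈ T then 9 * (b : ℝ) ^ 2 else 0 := by
    intro z
    set X := ∑ i, ((z i : ℤ) : ℝ) with hX
    split_ifs with hz
    · nlinarith [sq_nonneg (X ^ 2 - 25 / 8 * b), sq_nonneg X, sq_nonneg (b : ℝ)]
    · simp only [hT, Finset.mem_filter, Finset.mem_univ, true_and, not_le] at hz
      have hz' : 4 * X ^ 2 < b := by rw [hX]; exact_mod_cast hz
      nlinarith [sq_nonneg X]
  have hsum := Finset.sum_le_sum fun (z : Fin b → ℤˣ) (_ : z ∈ Finset.univ) => hpt z
  rw [Finset.sum_sub_distrib, Finset.sum_sub_distrib, ← Finset.mul_sum, sum_sq_sum_signs] at hsum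
  simp only [Finset.sum_ite_mem, Finset.univ_inter, Finset.sum_const, Finset.card_univ,
    Fintype.card_pi, Fintype.card_units_int, Finset.prod_const, Fintype.card_fin,
    nsmul_eq_mul] at hsum
  have h4 := sum_pow_four_sum_signs_le b
  push_cast at hsum
  have : (b : ℝ) ^ 2 * 2 ^ b ≤ (b : ℝ) ^ 2 * (6 * T.card) := by nlinarith
  have h6 : (2 : ℝ) ^ b ≤ 6 * T.card := le_of_mul_le_mul_left this (by positivity)
  have h6' : 2 ^ b ≤ 6 * T.card := by exact_mod_cast h6
  omega

/-- A sum of `q * b` random signs is at least `q * √b / 2` in absolute value with probability at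
least `12⁻¹ ^ q`: cut it into `q` blocks of length `b`, each of which has a large sum with
probability at least `1 / 12`. -/
theorem two_pow_le_card_sq_sum (q b : ℕ) :
    2 ^ (q * b) ≤ 12 ^ q *
      (Finset.univ.filter fun z : Fin (q * b) → ℤˣ =>
        (q : ℤ) ^ 2 * b ≤ 4 * (∑ i, (z i : ℤ)) ^ 2).card := by
  have hcard : (largeSums b).card ^ q ≤ (Finset.univ.filter fun z : Fin (q * b) → ℤˣ =>
        (q : ℤ) ^ 2 * b ≤ 4 * (∑ i, (z i : ℤ)) ^ 2).card := by
    rw [show (largeSums b).card ^ q =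
      (Fintype.piFinset fun _ : Fin q => largeSums b).card by simp]
    refine Finset.card_le_card_of_injOn
      (fun w i => w (finProdFinEquiv.symm i).1 (finProdFinEquiv.symm i).2) ?_ ?_
    · intro w hw
      rw [Finset.mem_coe, Fintype.mem_piFinset] at hw
      simp only [Finset.coe_filter, Finset.mem_univ, true_and, Set.mem_ofPred_eq]
      rw [← finProdFinEquiv.sum_comp, Fintype.sum_prod_type]
      simp only [Equiv.symm_apply_apply]
      have hlow : (q : ℝ) * (√b / 2) ≤ ∑ j, ((∑ i, (w j i : ℤ) : ℤ) : ℝ) := by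
        have : ∀ j, √b / 2 ≤ ((∑ i, (w j i : ℤ) : ℤ) : ℝ) := by
          intro j
          have := hw j
          simp only [largeSums, Finset.mem_filter, Finset.mem_univ, true_and] at this
          have h0 : (0 : ℝ) ≤ ((∑ i, (w j i : ℤ) : ℤ) : ℝ) := by exact_mod_cast this.1
          have h1 : (b : ℝ) ≤ 4 * ((∑ i, (w j i : ℤ) : ℤ) : ℝ) ^ 2 := by exact_mod_cast this.2
          have : √b ≤ 2 * ((∑ i, (w j i : ℤ) : ℤ) : ℝ) := by
            rw [Real.sqrt_le_left (by positivity)]; linarith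
          linarith
        calc _ = ∑ _j : Fin q, √b / 2 := by simp
          _ ≤ _ := Finset.sum_le_sum fun j _ => this j
      have hsq : ((q : ℝ) * (√b / 2)) ^ 2 ≤ (∑ j, ((∑ i, (w j i : ℤ) : ℤ) : ℝ)) ^ 2 :=
        pow_le_pow_left₀ (by positivity) hlow 2
      have hb : √(b : ℝ) ^ 2 = b := Real.sq_sqrt (by positivity)
      have : (q : ℝ) ^ 2 * b ≤ 4 * (∑ j, ((∑ i, (w j i : ℤ) : ℤ) : ℝ)) ^ 2 := by
        rw [← hb]; nlinarith
      exact_mod_cast this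
    · intro w _ w' _ h
      ext j i
      have := congrFun h (finProdFinEquiv (j, i))
      simp only [Equiv.symm_apply_apply] at this
      rw [this]
  calc 2 ^ (q * b) = (2 ^ b) ^ q := by rw [mul_comm, pow_mul]
    _ ≤ (12 * (largeSums b).card) ^ q := Nat.pow_le_pow_left (two_pow_le_card_largeSums b) q
    _ = 12 ^ q * (largeSums b).card ^ q := mul_pow _ _ _
    _ ≤ _ := Nat.mul_le_mul_left _ hcard

/-! ### The second moment method for homomorphisms of finite groups -/

/-- A surjective homomorphism of finite groups maps the uniform distribution to the uniform
distribution. -/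
theorem card_filter_mem_of_surjective {Γ H : Type*} [Group Γ] [Fintype Γ] [Group H] [Fintype H]
    [DecidableEq H] (f : Γ →* H) (hf : Function.Surjective f) (A : Finset H) :
    (Finset.univ.filter fun g => f g ∈ A).card * Fintype.card H = A.card * Fintype.card Γ := by
  have hfib : ∀ y, (Finset.univ.filter fun g => f g = y).card =
      (Finset.univ.filter fun g => f g = 1).card := fun y =>
    MonoidHom.card_fiber_eq_of_mem_range f (hf y) (hf 1)
  have h1 : (Finset.univ.filter fun g => f g ∈ A).card =
      A.card * (Finset.univ.filter fun g => f g = 1).card := by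
    rw [Finset.card_eq_sum_card_fiberwise (f := f) (t := A) (by intro g; simp)]
    rw [← smul_eq_mul, ← Finset.sum_const]
    refine Finset.sum_congr rfl fun y hy => ?_
    rw [← hfib y, Finset.filter_filter]
    congr 1
    ext g
    simp only [Finset.mem_filter, Finset.mem_univ, true_and]
    exact ⟨fun h => h.2, fun h => ⟨h ▸ hy, h⟩⟩
  have h2 : Fintype.card Γ = Fintype.card H * (Finset.univ.filter fun g => f g = 1).card := by
    rw [← Finset.card_univ (α := Γ),
      Finset.card_eq_sum_card_fiberwise (f := f) (t := Finset.univ) (by intro g; simp)]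
    simp [hfib]
  rw [h1, h2]
  ring

/-- The second moment method for homomorphisms `Y i : Γ →* H` that are pairwise jointly surjective,
so that for uniform `g` the `Y i g` are uniform and pairwise independent: the probability that no
`Y i g` lies in `A` is at most the inverse of the expected number of `i` with `Y i g ∈ A`. -/
theorem card_avoid_mul_le {Γ H ι : Type*} [Group Γ] [Fintype Γ] [Group H] [Fintype H]
    [DecidableEq H] [DecidableEq ι] (J : Finset ι) (Y : ι → Γ →* H)
    (hsurj : ∀ i ∈ J, Function.Surjective (Y i))
    (hpair : ∀ i ∈ J, ∀ j ∈ J, i ≠ j → Function.Surjective ((Y i).prod (Y j)))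
    (A : Finset H) (B : Finset Γ) (hB : ∀ g ∈ B, ∀ i ∈ J, Y i g ∉ A) :
    B.card * (J.card * A.card) ≤
      Fintype.card Γ * Fintype.card H := by
  set h : ℝ := (Fintype.card H : ℝ) with hh
  set G : ℝ := (Fintype.card Γ : ℝ) with hG
  have hpos : 0 < h := by rw [hh]; exact_mod_cast Fintype.card_pos
  have hGpos : 0 < G := by rw [hG]; exact_mod_cast Fintype.card_pos
  set p : ℝ := A.card / h with hp
  have hp0 : 0 ≤ p := by positivity
  let I : ι → Γ → ℝ := fun i g => if Y i g ∈ A then 1 else 0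
  have hone : ∀ i ∈ J, ∑ g, I i g = p * G := by
    intro i hi
    have := card_filter_mem_of_surjective (Y i) (hsurj i hi) A
    have h' : ((Finset.univ.filter fun g => Y i g ∈ A).card : ℝ) * h = A.card * G := by
      rw [hh, hG]; exact_mod_cast this
    simp only [I, Finset.sum_boole]
    rw [hp]
    field_simp
    linarith
  have htwo : ∀ i ∈ J, ∀ j ∈ J, i ≠ j → ∑ g, I i g * I j g = p ^ 2 * G := by
    intro i hi j hj hij
    have := card_filter_mem_of_surjective _ (hpair i hi j hj hij) (A ×ˢ A)
    rw [Finset.card_product, Fintype.card_prod] at this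
    have h' : ((Finset.univ.filter fun g => (Y i).prod (Y j) g ∈ A ×ˢ A).card : ℝ) * (h * h) =
        A.card * A.card * G := by
      rw [hh, hG]; exact_mod_cast this
    have h'' : ∑ g, I i g * I j g =
        ((Finset.univ.filter fun g => (Y i).prod (Y j) g ∈ A ×ˢ A).card : ℝ) := by
      rw [← Finset.sum_boole]
      refine Finset.sum_congr rfl fun g _ => ?_
      simp only [I, MonoidHom.prod_apply, Finset.mem_product]
      split_ifs <;> simp_all
    rw [h'', hp]
    field_simp
    linarith
  -- Covariances of distinct indicators vanish, and the variance of one is at most its mean `p`.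
  have hle : ∀ i ∈ J, ∀ j ∈ J, ∑ g, I i g * I j g ≤ (if i = j then p * G else 0) + p ^ 2 * G := by
    intro i hi j hj
    split_ifs with hij
    · subst hij
      have : ∑ g, I i g * I i g = p * G := by
        rw [← hone i hi]
        refine Finset.sum_congr rfl fun g _ => ?_
        simp only [I]; split_ifs <;> simp
      rw [this]
      have : 0 ≤ p ^ 2 * G := by positivity
      linarith
    · rw [htwo i hi j hj hij]; simp
  set L : ℝ := (J.card : ℝ) with hL
  have hL0 : 0 ≤ L := by positivity
  let W : Γ → ℝ := fun g => ∑ i ∈ J, I i g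
  have hW1 : ∑ g, W g = L * (p * G) := by
    simp only [W]
    rw [Finset.sum_comm, Finset.sum_congr rfl hone]
    simp [hL]
  have hW2 : ∑ g, W g ^ 2 ≤ L * (p * G) + L ^ 2 * (p ^ 2 * G) := by
    have : ∀ g, W g ^ 2 = ∑ i ∈ J, ∑ j ∈ J, I i g * I j g := by
      intro g; simp only [W]; rw [sq, Finset.sum_mul_sum]
    simp only [this]
    rw [Finset.sum_comm]
    calc _ = ∑ i ∈ J, ∑ j ∈ J, ∑ g, I i g * I j g :=
          Finset.sum_congr rfl fun i _ => Finset.sum_comm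
      _ ≤ ∑ i ∈ J, ∑ j ∈ J, ((if i = j then p * G else 0) + p ^ 2 * G) :=
          Finset.sum_le_sum fun i hi => Finset.sum_le_sum fun j hj => hle i hi j hj
      _ = _ := by
          simp only [Finset.sum_add_distrib, Finset.sum_ite_eq, Finset.sum_const, nsmul_eq_mul,
            Finset.sum_ite_mem, Finset.inter_self]
          ring
  -- Chebyshev's inequality: on `B` the count `W` vanishes, at distance `L * p` from its mean.
  have hcheb : (B.card : ℝ) * (L * p) ^ 2 ≤ (L * p) * G := by
    calc (B.card : ℝ) * (L * p) ^ 2 = ∑ g ∈ B, (W g - L * p) ^ 2 := by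
          rw [← nsmul_eq_mul, ← Finset.sum_const]
          refine Finset.sum_congr rfl fun g hg => ?_
          have : W g = 0 := by
            refine Finset.sum_eq_zero fun i hi => ?_
            exact if_neg (hB g hg i hi)
          rw [this]; ring
      _ ≤ ∑ g, (W g - L * p) ^ 2 :=
          Finset.sum_le_sum_of_subset_of_nonneg (Finset.subset_univ _) fun _ _ _ => sq_nonneg _
      _ = ∑ g, W g ^ 2 - 2 * (L * p) * ∑ g, W g + (L * p) ^ 2 * G := by
          rw [Finset.mul_sum, ← Finset.sum_sub_distrib,
            show (L * p) ^ 2 * G = ∑ _g : Γ, (L * p) ^ 2 by simp [hG, mul_comm],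
            ← Finset.sum_add_distrib]
          exact Finset.sum_congr rfl fun g _ => by ring
      _ ≤ _ := by rw [hW1]; nlinarith
  have hfin : (B.card : ℝ) * (J.card * A.card) ≤ Fintype.card Γ * Fintype.card H := by
    rw [← hL, ← hh, ← hG]
    rcases (mul_nonneg hL0 hp0).eq_or_lt with h0 | h0
    · have : L * A.card = 0 := by
        have : L * A.card = L * p * h := by rw [hp]; field_simp
        rw [this, ← h0, zero_mul]
      rw [this, mul_zero]; positivity
    · have h1 : (B.card : ℝ) * (L * p) ≤ G := by
        refine le_of_mul_le_mul_right ?_ h0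
        nlinarith
      have : (B.card : ℝ) * (L * A.card) = (B.card : ℝ) * (L * p) * h := by rw [hp]; field_simp
      rw [this]
      gcongr
  exact_mod_cast hfin

/-! ### Pairwise independence of shift products -/

/-- Prescribed values of `∏ d ∈ F, e (n + d)` are attained by some sign sequence `e`: solve for the
entry with the largest shift, `e (n + m)`, one `n` after the other. -/
theorem exists_prod_shift_eq (F : Finset ℕ) (m : ℕ) (hm : m ∈ F) (hmax : ∀ d ∈ F, d ≤ m)
    (r : ℕ → ℤˣ) (M : ℕ) :
    ∃ e : ℕ → ℤˣ, (∀ n < m, e n = 1) ∧ ∀ n < M, ∏ d ∈ F, e (n + d) = r n := by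
  induction M with
  | zero => exact ⟨fun _ => 1, fun _ _ => rfl, by simp⟩
  | succ M ih =>
    obtain ⟨e, he1, he2⟩ := ih
    refine ⟨Function.update e (M + m) (r M * ∏ d ∈ F.erase m, e (M + d)), ?_, ?_⟩
    · intro n hn
      rw [Function.update_of_ne (by omega), he1 n hn]
    · intro n hn
      rcases Nat.lt_succ_iff_lt_or_eq.1 hn with h | rfl
      · rw [← he2 n h]
        refine Finset.prod_congr rfl fun d hd => ?_
        rw [Function.update_of_ne]
        have := hmax d hd
        omega
      · rw [← Finset.mul_prod_erase F _ hm, Function.update_self]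
        have : ∏ d ∈ F.erase m, Function.update e (n + m)
            (r n * ∏ d ∈ F.erase m, e (n + d)) (n + d) = ∏ d ∈ F.erase m, e (n + d) := by
          refine Finset.prod_congr rfl fun d hd => ?_
          rw [Function.update_of_ne]
          have := Finset.ne_of_mem_erase hd
          omega
        rw [this, mul_assoc, Int.units_mul_self, mul_one]

/-- The entry of the `s`-th sequence at position `n` as a unit. Unlike `entry` it is `1` at
positions `n ≥ N`, which makes it multiplicative in `G`. -/
def unitEntry {N S : ℕ} (G : SeqFamily N S) (s : Fin S) (n : ℕ) : ℤˣ :=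
  if h : n < N then G s ⟨n, h⟩ else 1

theorem entry_eq_unitEntry {N S : ℕ} (G : SeqFamily N S) (s : Fin S) {n : ℕ} (h : n < N) :
    entry G s n = unitEntry G s n := by
  simp [entry, unitEntry, h]

/-- The vector with entries `∏ (d, s) ∈ D, e_{n + d}(s)` for `n < M`, as a homomorphism in the
family `G`. The sum of its entries is the correlation sum of the set `D` of pairs (shift, sequence).
-/
def shiftProd {N S : ℕ} (M : ℕ) (D : Finset (Fin N × Fin S)) : SeqFamily N S →* (Fin M → ℤˣ) where
  toFun G n := ∏ x ∈ D, unitEntry G x.2 (n + x.1)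
  map_one' := by
    ext n
    simp [unitEntry]
  map_mul' G G' := by
    ext n
    have : ∀ s n, unitEntry (G * G') s n = unitEntry G s n * unitEntry G' s n := by
      intro s n
      unfold unitEntry
      split_ifs <;> simp
    simp [this, Finset.prod_mul_distrib]

theorem shiftProd_apply {N S M : ℕ} (D : Finset (Fin N × Fin S)) (G : SeqFamily N S) (n : Fin M) :
    shiftProd M D G n = ∏ x ∈ D, unitEntry G x.2 (n + x.1) := rfl

/-- For distinct `D` and `D'` the product of the two shift products takes every value, already on
families that are trivial at all positions smaller than every shift of their sequence in
`D ∪ D'`. -/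
theorem exists_shiftProd_mul_eq {N S M : ℕ} {D D' : Finset (Fin N × Fin S)} (hne : D ≠ D')
    (hN : ∀ x ∈ D ∪ D', (x.1 : ℕ) + M ≤ N) (r : Fin M → ℤˣ) :
    ∃ G : SeqFamily N S, shiftProd M D G * shiftProd M D' G = r ∧
      ∀ s n, (∀ x ∈ D ∪ D', x.2 = s → n < (x.1 : ℕ)) → unitEntry G s n = 1 := by
  classical
  have hprod : ∀ f : Fin N × Fin S → ℤˣ,
      (∏ x ∈ D, f x) * ∏ x ∈ D', f x = ∏ x ∈ symmDiff D D', f x := by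
    intro f
    rw [← Finset.prod_sdiff (Finset.inter_subset_left (s₁ := D) (s₂ := D')),
      ← Finset.prod_sdiff (Finset.inter_subset_right (s₁ := D) (s₂ := D')),
      Finset.sdiff_inter_self_left, Finset.sdiff_inter_self_right, mul_mul_mul_comm,
      Int.units_mul_self, mul_one, symmDiff_def, Finset.sup_eq_union,
      Finset.prod_union disjoint_sdiff_sdiff]
  have hsub : symmDiff D D' ⊆ D ∪ D' := symmDiff_le_sup
  obtain ⟨x₀, hx₀⟩ : (symmDiff D D').Nonempty := by
    rw [Finset.nonempty_iff_ne_empty]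
    simpa [← Finset.bot_eq_empty, symmDiff_eq_bot] using hne
  -- Common pairs cancel. One sequence that occurs in the symmetric difference suffices.
  let T := (symmDiff D D').filter fun x => x.2 = x₀.2
  let F : Finset ℕ := T.image fun x => (x.1 : ℕ)
  have hF : F.Nonempty := ⟨x₀.1, Finset.mem_image_of_mem _ (Finset.mem_filter.2 ⟨hx₀, rfl⟩)⟩
  obtain ⟨e, he1, he2⟩ := exists_prod_shift_eq F (F.max' hF) (F.max'_mem hF)
    (fun d hd => F.le_max' d hd) (fun n => if h : n < M then r ⟨n, h⟩ else 1) M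
  refine ⟨fun s n => if s = x₀.2 then e n else 1, ?_, ?_⟩
  · ext n
    rw [Pi.mul_apply, shiftProd_apply, shiftProd_apply, hprod]
    have h1 : ∏ x ∈ F, e (n + x) = r n := by rw [he2 n n.2]; simp
    rw [← h1, Finset.prod_image, Finset.prod_filter]
    · congr 1
      refine Finset.prod_congr rfl fun x hx => ?_
      have := hN x (hsub hx)
      have hlt : (n : ℕ) + x.1 < N := by omega
      simp [unitEntry, hlt]
    · intro x hx y hy hxy
      have hx2 := (Finset.mem_filter.1 hx).2
      have hy2 := (Finset.mem_filter.1 hy).2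
      exact Prod.ext (Fin.ext hxy) (hx2.trans hy2.symm)
  · intro s n hn
    by_cases h2 : s = x₀.2
    · have : e n = 1 := by
        refine he1 n ?_
        obtain ⟨x, hx, hxm⟩ := Finset.mem_image.1 (F.max'_mem hF)
        rw [← hxm]
        exact hn x (hsub (Finset.mem_filter.1 hx).1) ((Finset.mem_filter.1 hx).2.trans h2.symm)
      simp [unitEntry, this]
    · simp [unitEntry, h2]

/-- Adjoining the pair `(0, s₀)` makes the shift products of distinct `D`, `D'` jointly surjective,
if the first `M` entries of the sequence `s₀` enter through that pair only: the ratio of the two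
vectors is prescribed by the remaining entries, and the first vector by those `M` entries. -/
theorem shiftProd_pair_surjective {N S M : ℕ} [NeZero N] (s₀ : Fin S)
    {D D' : Finset (Fin N × Fin S)}
    (hne : D ≠ D') (hM : 1 ≤ M) (hMN : M ≤ N) (hN : ∀ x ∈ D ∪ D', (x.1 : ℕ) + M ≤ N)
    (hs : ∀ x ∈ D ∪ D', x.2 = s₀ → M ≤ (x.1 : ℕ)) :
    Function.Surjective
      ((shiftProd M (insert (0, s₀) D)).prod (shiftProd M (insert (0, s₀) D'))) := by
  rintro ⟨u, w⟩
  obtain ⟨G, hG, hG1⟩ := exists_shiftProd_mul_eq hne hN (u * w)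
  let v : Fin M → ℤˣ := u * shiftProd M D G
  let G' : SeqFamily N S := fun s n => if h : s = s₀ ∧ (n : ℕ) < M then v ⟨n, h.2⟩ else 1
  have hG' : ∀ E ⊆ D ∪ D', shiftProd M E G' = 1 := by
    intro E hE
    ext n
    rw [shiftProd_apply, Finset.prod_eq_one]
    · rfl
    · intro x hx
      simp only [unitEntry, G']
      split_ifs with h1 h2
      · have := hs x (hE hx) h2.1
        omega
      · rfl
      · rfl
  have hins : ∀ E ⊆ D ∪ D', shiftProd M (insert (0, s₀) E) (G * G') = v * shiftProd M E G := by
    intro E hE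
    have hnot : (0, s₀) ∉ E := fun h => by
      have := hs _ (hE h) rfl
      simp at this
      omega
    ext n
    have h1 := congrFun (hG' E hE) n
    have hn : (n : ℕ) < N := n.2.trans_le hMN
    rw [map_mul, Pi.mul_apply, shiftProd_apply, shiftProd_apply, Finset.prod_insert hnot,
      Finset.prod_insert hnot, ← shiftProd_apply, ← shiftProd_apply, h1]
    simp only [Fin.val_zero, add_zero, Pi.one_apply, mul_one, Pi.mul_apply]
    rw [hG1 s₀ n fun x hx h => n.2.trans_le (hs x hx h), one_mul, mul_comm]
    simp [unitEntry, hn, G']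
  refine ⟨G * G', ?_⟩
  rw [MonoidHom.prod_apply, hins D Finset.subset_union_left, hins D' Finset.subset_union_right]
  have hsq : ∀ x : Fin M → ℤˣ, x * x = 1 := fun x => funext fun n => Int.units_mul_self _
  refine Prod.ext ?_ ?_
  · change u * shiftProd M D G * shiftProd M D G = u
    rw [mul_assoc, hsq, mul_one]
  · change u * shiftProd M D G * shiftProd M D' G = w
    rw [mul_assoc, hG, ← mul_assoc, hsq, one_mul]

/-! ### Bounds for the cross-correlation measure of a family -/

theorem natAbs_corrSum_le_crossCorr_of_mem {N S k : ℕ}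
    (p : Fin (N + 1) × (Fin k → Fin N) × (Fin k → Fin S))
    (h : Admissible (p.1 : ℕ) p.2.1 p.2.2) (G : SeqFamily N S) :
    (corrSum G p.1 p.2.1 p.2.2).natAbs ≤ crossCorr k G := by
  unfold crossCorr
  have hmem : p ∈
      Finset.univ.filter fun p : Fin (N + 1) × (Fin k → Fin N) × (Fin k → Fin S) =>
        Admissible (p.1 : ℕ) p.2.1 p.2.2 := by
    rw [Finset.mem_filter]
    exact ⟨Finset.mem_univ _, h⟩
  exact Finset.le_sup (f := fun p : Fin (N + 1) × (Fin k → Fin N) × (Fin k → Fin S) =>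
    (corrSum G (p.1 : ℕ) p.2.1 p.2.2).natAbs) hmem

theorem natAbs_corrSum_le_crossCorr {N S k M : ℕ} (hMN : M ≤ N) {d : Fin k → Fin N}
    {s : Fin k → Fin S} (h : Admissible M d s) (G : SeqFamily N S) :
    (corrSum G M d s).natAbs ≤ crossCorr k G :=
  natAbs_corrSum_le_crossCorr_of_mem (⟨M, Nat.lt_succ_of_le hMN⟩, d, s) h G

/-- The maximum is attained, unless there is no admissible choice and the measure is `0`. -/
theorem exists_crossCorr_eq {N S : ℕ} (k : ℕ) (G : SeqFamily N S) :
    crossCorr k G = 0 ∨ ∃ (M : ℕ) (d : Fin k → Fin N) (s : Fin k → Fin S), M ≤ N ∧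
      Admissible M d s ∧ crossCorr k G = (corrSum G M d s).natAbs := by
  unfold crossCorr
  rcases Finset.eq_empty_or_nonempty
    (Finset.univ.filter fun p : Fin (N + 1) × (Fin k → Fin N) × (Fin k → Fin S) =>
      Admissible (p.1 : ℕ) p.2.1 p.2.2) with h | h
  · left
    rw [h, Finset.sup_empty]
    rfl
  · right
    obtain ⟨p, hp, hmax⟩ := Finset.exists_mem_eq_sup _ h
      fun p : Fin (N + 1) × (Fin k → Fin N) × (Fin k → Fin S) =>
        (corrSum G (p.1 : ℕ) p.2.1 p.2.2).natAbs
    exact ⟨p.1, p.2.1, p.2.2, Nat.lt_succ_iff.1 p.1.2, (Finset.mem_filter.1 hp).2, hmax⟩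

/-- A set of `k` pairs (shift, sequence) gives an admissible choice once its elements are enumerated
with increasing shifts, so its correlation sum bounds `crossCorr` from below. -/
theorem natAbs_sum_shiftProd_le_crossCorr {N S k M : ℕ} (hM : 1 ≤ M) (hMN : M ≤ N)
    (D : Finset (Fin N × Fin S)) (hD : D.card = k) (hN : ∀ x ∈ D, (x.1 : ℕ) + M ≤ N)
    (G : SeqFamily N S) :
    (∑ n, (shiftProd M D G n : ℤ)).natAbs ≤ crossCorr k G := by
  -- The lexicographic order sorts the pairs by their shifts.
  let D' : Finset (Fin N ×ₗ Fin S) := D.map toLex.toEmbedding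
  have hD' : D'.card = k := by rw [Finset.card_map, hD]
  let o := D'.orderEmbOfFin hD'
  have ho : ∀ i, ofLex (o i) ∈ D := by
    intro i
    have : o i ∈ D' := D'.orderEmbOfFin_mem hD' i
    obtain ⟨x, hx, hxe⟩ := Finset.mem_map.1 this
    rw [← hxe]
    exact hx
  let d : Fin k → Fin N := fun i => (ofLex (o i)).1
  let s : Fin k → Fin S := fun i => (ofLex (o i)).2
  have hadm : Admissible M d s := by
    refine ⟨hM, ?_, ?_, ?_⟩
    · intro i j hij
      have h : o i ≤ o j := o.monotone hij
      rw [Prod.Lex.le_iff] at h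
      rcases h with h | h
      · exact h.le
      · exact h.1.le
    · intro i
      have : ((ofLex (o i)).1 : ℕ) + M ≤ N := hN _ (ho i)
      rw [add_comm]
      exact this
    · intro i j hij hs hd
      exact hij (o.injective (ofLex.injective (Prod.ext hd hs)))
  have hsum : corrSum G M d s = ∑ n, (shiftProd M D G n : ℤ) := by
    unfold corrSum
    rw [Finset.sum_range]
    refine Finset.sum_congr rfl fun n _ => ?_
    rw [shiftProd_apply, Units.coe_prod]
    have h1 : ∏ x ∈ D, ((unitEntry G x.2 (n + x.1) : ℤˣ) : ℤ) =
        ∏ y ∈ D', ((unitEntry G (ofLex y).2 (n + (ofLex y).1) : ℤˣ) : ℤ) := by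
      rw [Finset.prod_map]; rfl
    rw [h1, ← Finset.image_orderEmbOfFin_univ D' hD',
      Finset.prod_image (fun _ _ _ _ h => o.injective h)]
    refine Finset.prod_congr rfl fun i _ => ?_
    have : ((d i : ℕ)) + M ≤ N := hN _ (ho i)
    exact entry_eq_unitEntry G _ (by omega)
  rw [← hsum]
  exact natAbs_corrSum_le_crossCorr hMN hadm G

theorem abs_entry_le_one {N S : ℕ} (G : SeqFamily N S) (s : Fin S) (n : ℕ) : |entry G s n| ≤ 1 := by
  unfold entry
  split_ifs with h
  · rcases Int.units_eq_one_or (G s ⟨n, h⟩) with h | h <;> simp [h]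
  · simp

theorem abs_prod_entry_le_one {N S k : ℕ} (G : SeqFamily N S) (s : Fin k → Fin S) (n : Fin k → ℕ) :
    |∏ i, entry G (s i) (n i)| ≤ 1 := by
  rw [Finset.abs_prod]
  exact Finset.prod_le_one (fun _ _ => abs_nonneg _) fun _ _ => abs_entry_le_one _ _ _

theorem crossCorr_le {N S : ℕ} (k : ℕ) (G : SeqFamily N S) : crossCorr k G ≤ N := by
  rcases exists_crossCorr_eq k G with h | ⟨M, d, s, hM, -, h⟩
  · omega
  have h1 : |corrSum G M d s| ≤ ∑ _n ∈ Finset.range M, 1 :=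
    (Finset.abs_sum_le_sum_abs _ _).trans
      (Finset.sum_le_sum fun n _ => abs_prod_entry_le_one G _ fun i => n + d i)
  simp only [Finset.sum_const, Finset.card_range, nsmul_eq_mul, mul_one, Int.abs_eq_natAbs] at h1
  omega

/-- Changing an entry of the sequence `s₀` lowers the cross-correlation measure by at most
`2 * m s₀`, where `m s` is the number of occurrences of `s` in a maximising choice; in particular
the `m s` add up to at most `k`, however many sequences there are. -/
theorem exists_crossCorr_le_add {N S : ℕ} (k : ℕ) (G : SeqFamily N S) :
    ∃ m : Fin S → ℕ, ∑ s, m s ≤ k ∧ ∀ (s₀ : Fin S) (n₀ : Fin N) (G' : SeqFamily N S),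
      (∀ s n, (s, n) ≠ (s₀, n₀) → G' s n = G s n) → crossCorr k G ≤ crossCorr k G' + 2 * m s₀ := by
  rcases exists_crossCorr_eq k G with h | ⟨M, d, s, hM, hadm, hmax⟩
  · exact ⟨0, by simp, fun s₀ n₀ G' _ => by omega⟩
  refine ⟨fun t => (Finset.univ.filter fun i => s i = t).card, ?_, ?_⟩
  · rw [← Finset.card_eq_sum_card_fiberwise (by simp)]
    simp
  intro s₀ n₀ G' hG'
  have hle := natAbs_corrSum_le_crossCorr hM hadm G'
  -- The summands that involve the changed entry: at most one for each `i` with `s i = s₀`.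
  let B := (Finset.range M).filter fun n => ∃ i, s i = s₀ ∧ n + (d i : ℕ) = n₀
  have hB : B.card ≤ (Finset.univ.filter fun i => s i = s₀).card := by
    calc B.card ≤ ((Finset.univ.filter fun i => s i = s₀).image fun i => (n₀ : ℕ) - d i).card := by
          refine Finset.card_le_card fun n hn => ?_
          obtain ⟨i, hi, hni⟩ := (Finset.mem_filter.1 hn).2
          exact Finset.mem_image.2 ⟨i, by simpa using hi, by omega⟩
      _ ≤ _ := Finset.card_image_le
  have hdiff : |corrSum G M d s - corrSum G' M d s| ≤ 2 * B.card := by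
    unfold corrSum
    rw [← Finset.sum_sub_distrib]
    calc _ ≤ ∑ n ∈ Finset.range M, |∏ i, entry G (s i) (n + d i) - ∏ i, entry G' (s i) (n + d i)| :=
          Finset.abs_sum_le_sum_abs _ _
      _ ≤ ∑ n ∈ Finset.range M, if (∃ i, s i = s₀ ∧ n + (d i : ℕ) = n₀) then 2 else 0 := by
          refine Finset.sum_le_sum fun n _ => ?_
          split_ifs with h
          · refine (abs_sub _ _).trans ?_
            have h1 := abs_prod_entry_le_one G s fun i => n + d i
            have h2 := abs_prod_entry_le_one G' s fun i => n + d i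
            linarith
          · have : ∀ i, entry G' (s i) (n + d i) = entry G (s i) (n + d i) := by
              intro i
              unfold entry
              split_ifs with hi
              · rw [hG']
                intro he
                rw [Prod.mk.injEq] at he
                exact h ⟨i, he.1, congrArg Fin.val he.2⟩
              · rfl
            simp [this]
      _ = 2 * B.card := by
          rw [← Finset.sum_filter, Finset.sum_const, nsmul_eq_mul, mul_comm]
  rw [Int.abs_eq_natAbs] at hdiff
  change _ ≤ _ + 2 * (Finset.univ.filter fun i => s i = s₀).card
  omega

/-! ### The random family -/

theorem randomFamily_real_singleton {N S : ℕ} (G : SeqFamily N S) :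
    (randomFamily N S).real {G} = ((2 : ℝ) ^ (S * N))⁻¹ := by
  have h2 : ∀ x : ℤˣ, ProbabilityTheory.uniformOn (Set.univ : Set ℤˣ) {x} = (2 : ENNReal)⁻¹ := by
    intro x
    rw [ProbabilityTheory.uniformOn_univ]
    simp
  rw [measureReal_def, randomFamily, Measure.pi_singleton]
  simp only [Measure.pi_singleton, h2]
  simp [pow_mul, mul_comm S N]

instance {N S : ℕ} : IsProbabilityMeasure (randomFamily N S) := by
  unfold randomFamily
  infer_instance

theorem integral_randomFamily {N S : ℕ} (f : SeqFamily N S → ℝ) :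
    ∫ G, f G ∂(randomFamily N S) = ((2 : ℝ) ^ (S * N))⁻¹ * ∑ G, f G := by
  rw [integral_fintype .of_finite, Finset.mul_sum]
  simp [randomFamily_real_singleton]

theorem randomFamily_real_filter {N S : ℕ} (p : SeqFamily N S → Prop) [DecidablePred p] :
    (randomFamily N S).real {G | p G} =
      ((2 : ℝ) ^ (S * N))⁻¹ * (Finset.univ.filter p).card := by
  rw [← Finset.coe_filter_univ, ← sum_measureReal_singleton]
  simp [randomFamily_real_singleton, mul_comm]

theorem card_seqFamily (N S : ℕ) : Fintype.card (SeqFamily N S) = 2 ^ (S * N) := by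
  simp [pow_mul, mul_comm S N]

/-- The variance of the cross-correlation measure, bounded independently of `S`. -/
theorem variance_crossCorr_le (N S k : ℕ) :
    ∫ G, ((crossCorr k G : ℝ) - meanCrossCorr N S k) ^ 2 ∂(randomFamily N S) ≤ 2 * N * k ^ 2 := by
  let e : (Fin S × Fin N → ℤˣ) ≃ SeqFamily N S := Equiv.curry _ _ _
  choose m hm1 hm2 using fun G : SeqFamily N S => exists_crossCorr_le_add k G
  have h := efron_stein_of_decrease (fun x => (crossCorr k (e x) : ℝ))
    (fun x i => 2 * m (e x) i.1) ?_ (4 * N * k ^ 2) ?_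
  · rw [e.sum_comp fun G => (crossCorr k G : ℝ) ^ 2, e.sum_comp fun G => (crossCorr k G : ℝ)] at h
    simp only [Fintype.card_prod, Fintype.card_fin] at h
    have hmean : meanCrossCorr N S k =
        ((2 : ℝ) ^ (S * N))⁻¹ * ∑ G : SeqFamily N S, (crossCorr k G : ℝ) :=
      integral_randomFamily _
    rw [integral_randomFamily]
    have hexp : ∑ G : SeqFamily N S, ((crossCorr k G : ℝ) - meanCrossCorr N S k) ^ 2 =
        ∑ G : SeqFamily N S, (crossCorr k G : ℝ) ^ 2
          - 2 * meanCrossCorr N S k * ∑ G : SeqFamily N S, (crossCorr k G : ℝ)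
          + 2 ^ (S * N) * meanCrossCorr N S k ^ 2 := by
      have hc : ((Fintype.card (SeqFamily N S) : ℕ) : ℝ) = 2 ^ (S * N) := by
        rw [card_seqFamily]; push_cast; rfl
      rw [Finset.mul_sum, ← Finset.sum_sub_distrib, ← hc, ← nsmul_eq_mul, ← Finset.card_univ,
        ← Finset.sum_const, ← Finset.sum_add_distrib]
      exact Finset.sum_congr rfl fun G _ => by ring
    rw [hexp, hmean]
    have hpos : (0 : ℝ) < 2 ^ (S * N) := by positivity
    generalize (2 : ℝ) ^ (S * N) = P at *
    generalize ∑ G : SeqFamily N S, (crossCorr k G : ℝ) = A at *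
    generalize ∑ G : SeqFamily N S, (crossCorr k G : ℝ) ^ 2 = B at *
    have : P⁻¹ * (B - 2 * (P⁻¹ * A) * A + P * (P⁻¹ * A) ^ 2) = (P * B - A ^ 2) / P ^ 2 := by
      field_simp
      ring
    rw [this, div_le_iff₀ (by positivity)]
    linarith
  · rintro x ⟨s, n⟩
    have := hm2 (e x) s n (e (Function.update x (s, n) (-x (s, n)))) ?_
    · have h' : (crossCorr k (e x) : ℝ) ≤ crossCorr k (e (Function.update x (s, n) (-x (s, n)))) +
        2 * m (e x) s := by exact_mod_cast this
      linarith
    · intro s' n' hne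
      exact Function.update_of_ne hne _ _
  · intro x
    rw [Fintype.sum_prod_type]
    simp only [mul_pow, Finset.sum_const, Finset.card_univ, Fintype.card_fin, nsmul_eq_mul,
      ← Finset.mul_sum]
    have h1 : ∑ s, (m (e x) s : ℝ) ^ 2 ≤ (∑ s, (m (e x) s : ℝ)) ^ 2 :=
      Finset.sum_sq_le_sq_sum_of_nonneg fun _ _ => by positivity
    have h2 : (∑ s, (m (e x) s : ℝ)) ^ 2 ≤ (k : ℝ) ^ 2 :=
      pow_le_pow_left₀ (by positivity) (by exact_mod_cast hm1 (e x)) 2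
    nlinarith [show (0 : ℝ) ≤ N by positivity]

/-- The second moment method applied to the shift products of the sets `{(0, s₀)} ∪ D`, where `D`
runs over the `(k - 1)`-subsets of `R`: if the expected number of those that lie in `A` is at least
`m`, then the cross-correlation measure is at least `t` with probability at least `1 - 1 / m`. -/
theorem one_sub_le_real_le_crossCorr {N S k M : ℕ} [NeZero N] (s₀ : Fin S) (hk : 2 ≤ k) (hM : 1 ≤ M)
    (hMN : M ≤ N) (R : Finset (Fin N × Fin S)) (hN : ∀ x ∈ R, (x.1 : ℕ) + M ≤ N)
    (hs : ∀ x ∈ R, x.2 = s₀ → M ≤ (x.1 : ℕ)) (A : Finset (Fin M → ℤˣ)) (t : ℝ)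
    (hA : ∀ z ∈ A, t ≤ |((∑ n, (z n : ℤ) : ℤ) : ℝ)|) (m : ℕ) (hm : 1 ≤ m)
    (hL : 2 ^ M * m ≤ A.card * R.card.choose (k - 1)) :
    1 - 1 / (m : ℝ) ≤ (randomFamily N S).real {G | t ≤ (crossCorr k G : ℝ)} := by
  let J := R.powersetCard (k - 1)
  let Y : Finset (Fin N × Fin S) → SeqFamily N S →* (Fin M → ℤˣ) :=
    fun D => shiftProd M (insert (0, s₀) D)
  have hpair : ∀ D ∈ J, ∀ D' ∈ J, D ≠ D' → Function.Surjective ((Y D).prod (Y D')) := by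
    intro D hD D' hD' hne
    have hsub : D ∪ D' ⊆ R :=
      Finset.union_subset (Finset.mem_powersetCard.1 hD).1 (Finset.mem_powersetCard.1 hD').1
    exact shiftProd_pair_surjective s₀ hne hM hMN (fun x hx => hN x (hsub hx))
      fun x hx => hs x (hsub hx)
  have hsurj : ∀ D ∈ J, Function.Surjective (Y D) := by
    intro D hD
    obtain ⟨hDR, hDk⟩ := Finset.mem_powersetCard.1 hD
    have hne : D ≠ ∅ := by
      rintro rfl
      rw [Finset.card_empty] at hDk
      omega
    -- Surjectivity of one shift product is the first component of a pair with the empty set.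
    have h := shiftProd_pair_surjective s₀ hne hM hMN
      (fun x hx => hN x (hDR (by simpa using hx))) (fun x hx => hs x (hDR (by simpa using hx)))
    intro u
    obtain ⟨G, hG⟩ := h (u, 1)
    exact ⟨G, congrArg Prod.fst hG⟩
  let B : Finset (SeqFamily N S) := Finset.univ.filter fun G => ¬ t ≤ (crossCorr k G : ℝ)
  have hB : ∀ G ∈ B, ∀ D ∈ J, Y D G ∉ A := by
    intro G hG D hD hDA
    obtain ⟨hDR, hDk⟩ := Finset.mem_powersetCard.1 hD
    refine (Finset.mem_filter.1 hG).2 ((hA _ hDA).trans ?_)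
    have hnot : (0, s₀) ∉ D := fun h => by
      have := hs _ (hDR h) rfl
      simp at this
      omega
    have := natAbs_sum_shiftProd_le_crossCorr (k := k) hM hMN (insert (0, s₀) D)
      (by rw [Finset.card_insert_of_notMem hnot]; omega)
      (fun x hx => by
        rcases Finset.mem_insert.1 hx with rfl | hx
        · simpa using hMN
        · exact hN x (hDR hx)) G
    rw [← Int.cast_abs, Int.abs_eq_natAbs]
    exact_mod_cast this
  have hcard := card_avoid_mul_le J Y hsurj hpair A B hB
  rw [card_seqFamily, Finset.card_powersetCard, Fintype.card_pi] at hcard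
  simp only [Fintype.card_units_int, Finset.prod_const, Finset.card_univ, Fintype.card_fin] at hcard
  have hbm : B.card * m ≤ 2 ^ (S * N) := by
    refine Nat.le_of_mul_le_mul_right (c := 2 ^ M) ?_ (by positivity)
    calc B.card * m * 2 ^ M = B.card * (2 ^ M * m) := by ring
      _ ≤ B.card * (A.card * R.card.choose (k - 1)) := Nat.mul_le_mul_left _ hL
      _ = B.card * (R.card.choose (k - 1) * A.card) := by ring
      _ ≤ _ := hcard
  have hsplit := Finset.card_filter_add_card_filter_not
    (s := (Finset.univ : Finset (SeqFamily N S))) (fun G => t ≤ (crossCorr k G : ℝ))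
  rw [Finset.card_univ, card_seqFamily] at hsplit
  rw [randomFamily_real_filter]
  have hpos : (0 : ℝ) < 2 ^ (S * N) := by positivity
  have hm' : (0 : ℝ) < m := by exact_mod_cast hm
  have h1 : ((Finset.univ.filter fun G : SeqFamily N S => t ≤ (crossCorr k G : ℝ)).card : ℝ) +
      B.card = 2 ^ (S * N) := by
    exact_mod_cast hsplit
  have h3 : (B.card : ℝ) * m ≤ 2 ^ (S * N) := by exact_mod_cast hbm
  have h4 : (B.card : ℝ) ≤ 2 ^ (S * N) / m := by rwa [le_div_iff₀ hm']
  have h5 : (2 : ℝ) ^ (S * N) - 2 ^ (S * N) / m ≤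
      (Finset.univ.filter fun G : SeqFamily N S => t ≤ (crossCorr k G : ℝ)).card := by linarith
  calc 1 - 1 / (m : ℝ) = ((2 : ℝ) ^ (S * N))⁻¹ * (2 ^ (S * N) - 2 ^ (S * N) / m) := by
        field_simp
    _ ≤ _ := by gcongr

/-! ### Lower bounds for the mean and the maximum -/

/-- Markov's inequality. -/
theorem mul_real_le_meanCrossCorr (N S k : ℕ) (t : ℝ) :
    t * (randomFamily N S).real {G | t ≤ (crossCorr k G : ℝ)} ≤ meanCrossCorr N S k :=
  mul_meas_ge_le_integral_of_nonneg (.of_forall fun _ => Nat.cast_nonneg _) .of_finite t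

/-- If the sets of `k - 1` pairs are numerous enough, the mean of the cross-correlation measure is
of order at least `√(q * N)`. The correlation sums used have `M = q * b` terms with
`N / 6 ≤ M ≤ N / 3`, one shift equal to `0` and the other `k - 1` shifts between `M` and `N - M`. -/
theorem sq_meanCrossCorr_ge {N S k q : ℕ} (hk : 2 ≤ k) (hS : 1 ≤ S) (hq : 1 ≤ q) (hqN : 6 * q ≤ N)
    (hL : ∀ r, N * S ≤ 3 * r → 2 * 12 ^ q ≤ r.choose (k - 1)) :
    (q : ℝ) * N / 96 ≤ meanCrossCorr N S k ^ 2 := by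
  have : NeZero N := ⟨by omega⟩
  set b := N / (3 * q) with hb
  have hb1 : 3 * (q * b) ≤ N := by
    have := Nat.mul_div_le N (3 * q)
    rw [← hb] at this
    linarith
  have hb2 : N ≤ 6 * (q * b) := by
    have := Nat.lt_mul_div_succ N (show 0 < 3 * q by omega)
    rw [← hb] at this
    nlinarith
  let R : Finset (Fin N × Fin S) :=
    Finset.Icc ⟨q * b, by omega⟩ ⟨N - q * b, by omega⟩ ×ˢ Finset.univ
  have hR : ∀ x ∈ R, q * b ≤ (x.1 : ℕ) ∧ (x.1 : ℕ) ≤ N - q * b := by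
    intro x hx
    have := Finset.mem_Icc.1 (Finset.mem_product.1 hx).1
    exact this
  have hRcard : N * S ≤ 3 * R.card := by
    rw [Finset.card_product, Fin.card_Icc, Finset.card_univ, Fintype.card_fin, ← mul_assoc]
    refine Nat.mul_le_mul_right _ ?_
    simp only
    omega
  have hprob := one_sub_le_real_le_crossCorr (k := k) (M := q * b) (⟨0, hS⟩ : Fin S) hk (by omega)
    (by omega) R (fun x hx => by have := hR x hx; omega) (fun x hx _ => (hR x hx).1)
    (Finset.univ.filter fun z : Fin (q * b) → ℤˣ =>
        (q : ℤ) ^ 2 * b ≤ 4 * (∑ i, (z i : ℤ)) ^ 2)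
    √((q : ℝ) ^ 2 * b / 4) (fun z hz => by
      rw [← Real.sqrt_sq_eq_abs]
      refine Real.sqrt_le_sqrt ?_
      have h : ((q : ℝ)) ^ 2 * b ≤ 4 * ((∑ i, (z i : ℤ) : ℤ) : ℝ) ^ 2 := by
        exact_mod_cast (Finset.mem_filter.1 hz).2
      linarith) 2 (by norm_num) (by
      have h1 := two_pow_le_card_sq_sum q b
      have h2 := hL _ hRcard
      generalize Finset.card (Finset.filter (fun z : Fin (q * b) → ℤˣ =>
        (q : ℤ) ^ 2 * b ≤ 4 * (∑ i, (z i : ℤ)) ^ 2) Finset.univ) = a at *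
      calc 2 ^ (q * b) * 2 ≤ 12 ^ q * a * 2 := Nat.mul_le_mul_right _ h1
        _ = a * (2 * 12 ^ q) := by ring
        _ ≤ _ := Nat.mul_le_mul_left _ h2)
  have hmean := mul_real_le_meanCrossCorr N S k √((q : ℝ) ^ 2 * b / 4)
  have hhalf : √((q : ℝ) ^ 2 * b / 4) / 2 ≤ meanCrossCorr N S k := by
    refine le_trans ?_ hmean
    rw [div_eq_mul_one_div]
    refine mul_le_mul_of_nonneg_left ?_ (Real.sqrt_nonneg _)
    refine le_trans ?_ hprob
    norm_num
  have hsq := pow_le_pow_left₀ (by positivity) hhalf 2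
  rw [div_pow, Real.sq_sqrt (by positivity)] at hsq
  have hb2' : (N : ℝ) ≤ 6 * (q * b) := by exact_mod_cast hb2
  nlinarith [show (0 : ℝ) ≤ q by positivity]

/-- If `S` is very large, then with high probability some product of `k` distinct sequences, one of
them the first, is identically `1`, and the cross-correlation measure takes its largest possible
value `N`. -/
theorem one_sub_le_real_length_le_crossCorr {N S k m : ℕ} (hN : 1 ≤ N) (hS : 1 ≤ S) (hk : 2 ≤ k)
    (hm : 1 ≤ m) (hL : 2 ^ N * m ≤ (S - 1).choose (k - 1)) :
    1 - 1 / (m : ℝ) ≤ (randomFamily N S).real {G | (N : ℝ) ≤ (crossCorr k G : ℝ)} := by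
  have : NeZero N := ⟨by omega⟩
  let s₀ : Fin S := ⟨0, hS⟩
  let R : Finset (Fin N × Fin S) := {0} ×ˢ Finset.univ.erase s₀
  have hR : ∀ x ∈ R, x.1 = 0 ∧ x.2 ≠ s₀ := by
    intro x hx
    have h := Finset.mem_product.1 hx
    exact ⟨Finset.mem_singleton.1 h.1, Finset.ne_of_mem_erase h.2⟩
  refine one_sub_le_real_le_crossCorr s₀ hk hN le_rfl R (fun x hx => by simp [(hR x hx).1])
    (fun x hx h => absurd h (hR x hx).2) {1} N (fun z hz => ?_) m hm ?_
  · rw [Finset.mem_singleton.1 hz]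
    simp
  · simpa [R, Finset.card_erase_of_mem] using hL

/-! ### The two regimes of the parameters -/

/-- The binomial coefficient is at least `exp (Λ / 2) ^ (k - 1)`, and `k - 1 ≥ k / 2`. -/
theorem exp_le_choose {r k : ℕ} {l Λ : ℝ} (hk : 2 ≤ k) (hΛ : 0 ≤ Λ) (hkl : k * l ≤ Λ)
    (hr : 2 * k * Real.exp (Λ / 2) ≤ r) :
    Real.exp (k ^ 2 * l / 4) ≤ (r.choose (k - 1) : ℕ) := by
  obtain ⟨j, rfl⟩ : ∃ j, k = j + 1 := ⟨k - 1, by omega⟩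
  have hj : (1 : ℝ) ≤ j := by exact_mod_cast (by omega : 1 ≤ j)
  rw [Nat.add_sub_cancel]
  push_cast at *
  have he : 1 ≤ Real.exp (Λ / 2) := Real.one_le_exp (by linarith)
  have hjr : j ≤ r := by
    have : (j : ℝ) ≤ r := by nlinarith
    exact_mod_cast this
  have h1 := Nat.pow_le_choose (α := ℝ) j r
  have h2 : (j.factorial : ℝ) ≤ (j : ℝ) ^ j := by exact_mod_cast Nat.factorial_le_pow j
  have h3 : (j : ℝ) * Real.exp (Λ / 2) ≤ ((r + 1 - j : ℕ) : ℝ) := by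
    rw [Nat.cast_sub (by omega)]
    push_cast
    nlinarith
  calc Real.exp ((j + 1) ^ 2 * l / 4) ≤ Real.exp (j * (Λ / 2)) := by
        refine Real.exp_le_exp.2 ?_
        nlinarith
    _ = Real.exp (Λ / 2) ^ j := by rw [← Real.exp_nat_mul]
    _ = (j * Real.exp (Λ / 2)) ^ j / (j : ℝ) ^ j := by
        rw [mul_pow]; field_simp
    _ ≤ ((r + 1 - j : ℕ) : ℝ) ^ j / (j : ℝ) ^ j := by gcongr
    _ ≤ ((r + 1 - j : ℕ) : ℝ) ^ j / j.factorial := by gcongr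
    _ ≤ _ := by exact_mod_cast h1

theorem exists_threshold (C m : ℕ) (hC : 1 ≤ C) :
    ∃ N₀ : ℕ, ∀ N ≥ N₀, 1 ≤ N ∧ 24 * C * (1 + m) ≤ Real.log (Real.log N) ∧
      ∀ Λ ≥ Real.log N, 1 ≤ Λ ∧ 24 * C * Λ ^ 3 ≤ Real.exp (Λ / 2) := by
  have hlo := (isLittleO_pow_exp_pos_mul_atTop (k := 3) (b := 1 / 2) (by norm_num)).bound
    (show (0 : ℝ) < 1 / (24 * C) by positivity)
  obtain ⟨Λ₀, hΛ₀⟩ := Filter.eventually_atTop.1 (hlo.and (Filter.eventually_ge_atTop 1))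
  have hlog : Filter.Tendsto (fun N : ℕ => Real.log N) Filter.atTop Filter.atTop :=
    Real.tendsto_log_atTop.comp tendsto_natCast_atTop_atTop
  have hloglog := Real.tendsto_log_atTop.comp hlog
  obtain ⟨N₀, hN₀⟩ := Filter.eventually_atTop.1 ((Filter.eventually_ge_atTop 1).and
    ((hloglog.eventually_ge_atTop (24 * C * (1 + m))).and (hlog.eventually_ge_atTop Λ₀)))
  refine ⟨N₀, fun N hN => ?_⟩
  obtain ⟨h1, h2, h3⟩ := hN₀ N hN
  refine ⟨h1, h2, fun Λ hΛ => ?_⟩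
  obtain ⟨h4, h5⟩ := hΛ₀ Λ (le_trans h3 hΛ)
  refine ⟨h5, ?_⟩
  rw [Real.norm_of_nonneg (by positivity), Real.norm_of_nonneg (by positivity)] at h4
  have hC' : (0 : ℝ) < C := by exact_mod_cast hC
  rw [div_mul_eq_mul_div, one_mul, le_div_iff₀ (by positivity)] at h4
  rw [show Λ / 2 = 1 / 2 * Λ by ring]
  linarith

theorem two_mul_twelve_pow_le_choose {C k r m : ℕ} {l Λ : ℝ} (hC : 1 ≤ C) (hk : 2 ≤ k)
    (hl : 24 * C * (1 + m) ≤ l) (hkl : k * l ≤ Λ) (hΛ : 0 ≤ Λ)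
    (hr : 2 * k * Real.exp (Λ / 2) ≤ r) : 2 * 12 ^ (C * k ^ 2) ≤ r.choose (k - 1) := by
  have hC' : (1 : ℝ) ≤ C := by exact_mod_cast hC
  have hk' : (2 : ℝ) ≤ k := by exact_mod_cast hk
  have hexp1 := Real.exp_one_gt_d9
  have h12 : (12 : ℝ) ≤ Real.exp 3 := by
    rw [show (3 : ℝ) = ((3 : ℕ) : ℝ) * 1 by norm_num, Real.exp_nat_mul]
    calc (12 : ℝ) ≤ 2.7182818283 ^ 3 := by norm_num
      _ ≤ _ := by gcongr
  have h2 : (2 : ℝ) ≤ Real.exp 1 := by linarith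
  have hq : 1 ≤ (C : ℝ) * k ^ 2 := by nlinarith
  have hl' : 16 * (C : ℝ) ≤ l := by
    have : 0 ≤ (C : ℝ) * m := by positivity
    linarith
  have hkl' : (k : ℝ) ^ 2 * (16 * C) ≤ k ^ 2 * l := by gcongr
  have hfin : (2 : ℝ) * 12 ^ (C * k ^ 2) ≤ (r.choose (k - 1) : ℕ) := by
    calc (2 : ℝ) * 12 ^ (C * k ^ 2) ≤ Real.exp 1 * Real.exp 3 ^ (C * k ^ 2) := by gcongr
      _ = Real.exp (1 + 3 * (C * k ^ 2)) := by
          rw [← Real.exp_nat_mul, ← Real.exp_add]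
          push_cast
          ring_nf
      _ ≤ Real.exp (k ^ 2 * l / 4) := Real.exp_le_exp.2 (by linarith)
      _ ≤ _ := exp_le_choose hk hΛ hkl hr
  exact_mod_cast hfin

theorem two_pow_mul_le_choose {C k r m N : ℕ} {l Λ : ℝ} (hk : 2 ≤ k) (hN : 1 ≤ N)
    (hNk : N ≤ 6 * (C * k ^ 2)) (hl : 24 * C * (1 + m) ≤ l) (hkl : k * l ≤ Λ) (hΛ : 0 ≤ Λ)
    (hr : 2 * k * Real.exp (Λ / 2) ≤ r) : 2 ^ N * m ≤ r.choose (k - 1) := by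
  have hN' : (1 : ℝ) ≤ N := by exact_mod_cast hN
  have hNk' : (N : ℝ) ≤ 6 * (C * k ^ 2) := by exact_mod_cast hNk
  have h2 : (2 : ℝ) ≤ Real.exp 1 := by have := Real.exp_one_gt_d9; linarith
  have hmexp : (m : ℝ) ≤ Real.exp m := by have := Real.add_one_le_exp (m : ℝ); linarith
  have h1 : (k : ℝ) ^ 2 * (24 * C * (1 + m)) ≤ k ^ 2 * l := by gcongr
  have h3 : (N : ℝ) * (1 + m) ≤ 6 * (C * k ^ 2) * (1 + m) := by gcongr
  have h4 : (m : ℝ) ≤ N * m := le_mul_of_one_le_left (by positivity) hN'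
  have hfin : (2 : ℝ) ^ N * m ≤ (r.choose (k - 1) : ℕ) := by
    calc (2 : ℝ) ^ N * m ≤ Real.exp 1 ^ N * Real.exp m := by gcongr
      _ = Real.exp (N + m) := by rw [← Real.exp_nat_mul, ← Real.exp_add, mul_one]
      _ ≤ Real.exp (k ^ 2 * l / 4) := Real.exp_le_exp.2 (by linarith)
      _ ≤ _ := exp_le_choose hk hΛ hkl hr
  exact_mod_cast hfin

/-- In the given range of `k`, either the squared mean exceeds the order `N * k ^ 2` of the variance
by a large constant factor, or the largest possible value `N` is attained with high probability. The
two cases are `6 * C * k ^ 2 ≤ N` and its negation. -/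
theorem large_mean_or_likely_max (C m : ℕ) (hC : 1 ≤ C) (hm : 1 ≤ m) :
    ∃ N₀ : ℕ, ∀ N S k : ℕ, N₀ ≤ N → 1 ≤ S → 2 ≤ k →
      (k : ℝ) ≤ (Real.log N + Real.log S) / Real.log (Real.log N) →
      0 < N ∧ ((C : ℝ) * k ^ 2 * N / 96 ≤ meanCrossCorr N S k ^ 2 ∨
        1 - 1 / (m : ℝ) ≤ (randomFamily N S).real {G | (N : ℝ) ≤ (crossCorr k G : ℝ)}) := by
  obtain ⟨N₀, hN₀⟩ := exists_threshold C m hC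
  refine ⟨N₀, fun N S k hN hS hk hkΛ => ?_⟩
  obtain ⟨hN1, hl, hΛall⟩ := hN₀ N hN
  refine ⟨hN1, ?_⟩
  set l := Real.log (Real.log N)
  set Λ := Real.log N + Real.log S with hΛ_def
  have hC' : (1 : ℝ) ≤ C := by exact_mod_cast hC
  have hN' : (1 : ℝ) ≤ N := by exact_mod_cast hN1
  have hS' : (1 : ℝ) ≤ S := by exact_mod_cast hS
  have hk' : (2 : ℝ) ≤ k := by exact_mod_cast hk
  have hl1 : 1 ≤ l := by
    have : 0 ≤ (C : ℝ) * m := by positivity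
    linarith
  obtain ⟨hΛ1, hΛ3⟩ := hΛall Λ (by have := Real.log_nonneg hS'; linarith)
  have hkl : k * l ≤ Λ := by rwa [le_div_iff₀ (by linarith)] at hkΛ
  have hkΛ' : (k : ℝ) ≤ Λ := (le_mul_of_one_le_right (by positivity) hl1).trans hkl
  have hexp : Real.exp (Λ / 2) * Real.exp (Λ / 2) = N * S := by
    rw [← Real.exp_add, add_halves, hΛ_def, Real.exp_add, Real.exp_log (by linarith),
      Real.exp_log (by linarith)]
  have hepos := Real.exp_pos (Λ / 2)
  have he1 : 1 ≤ Real.exp (Λ / 2) := Real.one_le_exp (by linarith)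
  have hk3 : 24 * C * (k : ℝ) ^ 3 ≤ Real.exp (Λ / 2) := by
    refine le_trans ?_ hΛ3
    gcongr
  by_cases hcase : 6 * (C * k ^ 2) ≤ N
  · left
    have hmean := sq_meanCrossCorr_ge (S := S) hk hS
      (Nat.one_le_iff_ne_zero.2 (by positivity)) hcase fun r hr => by
        have hr' : (N : ℝ) * S ≤ 3 * r := by exact_mod_cast hr
        have h6 : 6 * (k : ℝ) ≤ Real.exp (Λ / 2) := by
          refine le_trans ?_ hk3
          have h1 : (k : ℝ) ≤ k ^ 3 := le_self_pow₀ (by linarith) (by norm_num)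
          have h2 : (k : ℝ) ^ 3 ≤ C * k ^ 3 := le_mul_of_one_le_left (by positivity) hC'
          linarith
        have h7 := mul_le_mul_of_nonneg_right h6 hepos.le
        exact two_mul_twelve_pow_le_choose hC hk hl hkl (by linarith) (by linarith)
    push_cast at hmean
    exact hmean
  · right
    have hNk : N ≤ 6 * (C * k ^ 2) := (not_le.1 hcase).le
    refine one_sub_le_real_length_le_crossCorr hN1 hS hk hm
      (two_pow_mul_le_choose hk hN1 hNk hl hkl (by linarith) ?_)
    have hNk' : (N : ℝ) ≤ 6 * (C * k ^ 2) := by exact_mod_cast hNk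
    have h4 : 4 * (N : ℝ) * k ≤ Real.exp (Λ / 2) := by
      calc 4 * (N : ℝ) * k ≤ 4 * (6 * (C * k ^ 2)) * k := by gcongr
        _ = 24 * C * k ^ 3 := by ring
        _ ≤ _ := hk3
    have hSbig : 4 * k * Real.exp (Λ / 2) ≤ S := by
      have h := mul_le_mul_of_nonneg_right h4 hepos.le
      rw [hexp] at h
      exact le_of_mul_le_mul_left (by linarith) (by linarith : (0 : ℝ) < N)
    have h1 : (2 : ℝ) * 1 ≤ k * Real.exp (Λ / 2) := by gcongr
    rw [Nat.cast_sub hS, Nat.cast_one]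
    linarith

/-! ### Concentration of the ratio -/

theorem meanCrossCorr_nonneg (N S k : ℕ) : 0 ≤ meanCrossCorr N S k :=
  integral_nonneg fun _ => Nat.cast_nonneg _

theorem meanCrossCorr_le (N S k : ℕ) : meanCrossCorr N S k ≤ N := by
  calc meanCrossCorr N S k ≤ ∫ _, (N : ℝ) ∂(randomFamily N S) :=
        integral_mono .of_finite .of_finite fun G => Nat.cast_le.2 (crossCorr_le k G)
    _ = N := by simp

/-- Chebyshev's inequality with `variance_crossCorr_le`; `192 = 2 * 96` collects the constants of
the variance and of the mean. -/
theorem ratio_of_large_mean {N S k C : ℕ} {ε : ℝ} (hε : 0 < ε) (hN : 0 < N) (hk : 2 ≤ k)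
    (hC : 192 / ε ^ 3 ≤ C) (hC1 : 1 ≤ C)
    (h : (C : ℝ) * k ^ 2 * N / 96 ≤ meanCrossCorr N S k ^ 2) :
    1 - ε ≤ (randomFamily N S).real {G : SeqFamily N S |
      1 - ε < (crossCorr k G : ℝ) / meanCrossCorr N S k ∧
      (crossCorr k G : ℝ) / meanCrossCorr N S k < 1 + ε} := by
  have hN' : (0 : ℝ) < N := by exact_mod_cast hN
  have hk' : (0 : ℝ) < k := by exact_mod_cast (by omega : 0 < k)
  have hC' : (0 : ℝ) < C := by exact_mod_cast hC1
  set E := meanCrossCorr N S k with hE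
  have hE0 : 0 < E := by
    refine (meanCrossCorr_nonneg N S k).lt_of_ne' fun h0 => ?_
    rw [← hE] at h0
    rw [h0] at h
    have : 0 < (C : ℝ) * k ^ 2 * N / 96 := by positivity
    linarith
  set T := {G : SeqFamily N S | 1 - ε < (crossCorr k G : ℝ) / E ∧ (crossCorr k G : ℝ) / E < 1 + ε}
  have hvar := variance_crossCorr_le N S k
  have hmarkov := mul_meas_ge_le_integral_of_nonneg (μ := randomFamily N S)
    (f := fun G => ((crossCorr k G : ℝ) - E) ^ 2) (.of_forall fun _ => sq_nonneg _) .of_finite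
    ((ε * E) ^ 2)
  have hsub : Tᶜ ⊆ {G : SeqFamily N S | (ε * E) ^ 2 ≤ ((crossCorr k G : ℝ) - E) ^ 2} := by
    intro G hG
    by_contra hlt
    refine hG ?_
    rw [Set.mem_ofPred_eq, not_le] at hlt
    have habs := abs_lt_of_sq_lt_sq hlt (by positivity)
    rw [abs_lt] at habs
    refine ⟨?_, ?_⟩
    · rw [lt_div_iff₀ hE0]; linarith
    · rw [div_lt_iff₀ hE0]; linarith
  have hle : (randomFamily N S).real Tᶜ ≤ ε := by
    refine (measureReal_mono hsub).trans ?_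
    have h1 : (ε * E) ^ 2 * (randomFamily N S).real
        {G : SeqFamily N S | (ε * E) ^ 2 ≤ ((crossCorr k G : ℝ) - E) ^ 2} ≤ 2 * N * k ^ 2 :=
      hmarkov.trans hvar
    have h2 : 2 * (N : ℝ) * k ^ 2 ≤ (ε * E) ^ 2 * ε := by
      rw [div_le_iff₀ (by positivity)] at hC
      calc 2 * (N : ℝ) * k ^ 2 = 192 * (k ^ 2 * N / 96) := by ring
        _ ≤ (C * ε ^ 3) * (k ^ 2 * N / 96) := by gcongr
        _ = ε ^ 3 * ((C : ℝ) * k ^ 2 * N / 96) := by ring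
        _ ≤ ε ^ 3 * E ^ 2 := by gcongr
        _ = _ := by ring
    exact le_of_mul_le_mul_left (h1.trans h2) (by positivity)
  have := probReal_compl_eq_one_sub (μ := randomFamily N S) (s := T) (Set.toFinite T).measurableSet
  linarith

/-- If the measure equals its maximal value `N` with high probability, then its mean is close to
`N` as well. -/
theorem ratio_of_likely_max {N S k m : ℕ} {ε : ℝ} (hε : 0 < ε) (hN : 0 < N)
    (hm : 3 / ε ≤ m) (hm3 : 3 ≤ m)
    (h : 1 - 1 / (m : ℝ) ≤ (randomFamily N S).real {G | (N : ℝ) ≤ (crossCorr k G : ℝ)}) :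
    1 - ε ≤ (randomFamily N S).real {G : SeqFamily N S |
      1 - ε < (crossCorr k G : ℝ) / meanCrossCorr N S k ∧
      (crossCorr k G : ℝ) / meanCrossCorr N S k < 1 + ε} := by
  have hN' : (0 : ℝ) < N := by exact_mod_cast hN
  have hm3' : (3 : ℝ) ≤ m := by exact_mod_cast hm3
  have hmε : 3 ≤ m * ε := by rwa [div_le_iff₀ hε] at hm
  have hinv : 1 / (m : ℝ) ≤ ε := by
    rw [div_le_iff₀ (by linarith)]; linarith
  have hmean : N * (1 - 1 / (m : ℝ)) ≤ meanCrossCorr N S k :=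
    (mul_le_mul_of_nonneg_left h hN'.le).trans (mul_real_le_meanCrossCorr N S k N)
  have hEle := meanCrossCorr_le N S k
  have h3 : 1 / (m : ℝ) ≤ 1 / 3 := by gcongr
  have hE0 : 0 < meanCrossCorr N S k := by nlinarith
  refine le_trans (by linarith) (h.trans (measureReal_mono ?_))
  intro G hG
  have hG1 : (N : ℝ) ≤ crossCorr k G := hG
  have hG2 : (crossCorr k G : ℝ) ≤ N := by exact_mod_cast crossCorr_le k G
  refine ⟨?_, ?_⟩
  · rw [lt_div_iff₀ hE0]; nlinarith
  · rw [div_lt_iff₀ hE0]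
    have h1 : 1 < (1 + ε) * (1 - 1 / (m : ℝ)) := by
      have hm0 : (m : ℝ) * (1 / m) = 1 := by field_simp
      have h4 : (1 : ℝ) / m ≤ ε / 3 := by
        rw [div_le_iff₀ (by linarith)]; linarith
      nlinarith
    nlinarith

end CrossCorrelation

theorem theorem2 (ε : ℝ) (hε : 0 < ε) :
    ∃ N₀ : ℕ, ∀ N S k : ℕ, N₀ ≤ N → 1 ≤ S → 12 * Real.logb 2 (S : ℝ) ≤ (N : ℝ) →
      2 ≤ k →
      (k : ℝ) ≤ (Real.log (N : ℝ) + Real.log (S : ℝ)) / Real.log (Real.log (N : ℝ)) →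
      1 - ε ≤ (CrossCorrelation.randomFamily N S).real
        {G : CrossCorrelation.SeqFamily N S |
          1 - ε < (CrossCorrelation.crossCorr k G : ℝ) / CrossCorrelation.meanCrossCorr N S k ∧
          (CrossCorrelation.crossCorr k G : ℝ) / CrossCorrelation.meanCrossCorr N S k
            < 1 + ε} := by
  obtain ⟨C, hC⟩ := exists_nat_ge (192 / ε ^ 3)
  obtain ⟨m, hm⟩ := exists_nat_ge (3 / ε)
  have hC' : 192 / ε ^ 3 ≤ ((C + 1 : ℕ) : ℝ) := by push_cast; linarith
  have hm' : 3 / ε ≤ ((m + 3 : ℕ) : ℝ) := by push_cast; linarith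
  obtain ⟨N₀, hN₀⟩ :=
    CrossCorrelation.large_mean_or_likely_max (C + 1) (m + 3) (by omega) (by omega)
  refine ⟨N₀, fun N S k hN hS _ hk hkΛ => ?_⟩
  rcases hN₀ N S k hN hS hk hkΛ with ⟨hN1, h | h⟩
  · exact CrossCorrelation.ratio_of_large_mean hε hN1 hk hC' (by omega) h
  · exact CrossCorrelation.ratio_of_likely_max hε hN1 hm' (by omega) h
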